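/- Let $\mathbf{F}$ be $\mathbb{R}$ or $\mathbb{C}$; all locally convex spaces are over $\mathbf{F}$ and Hausdorff. Let $X$ be a Tychonoff (= completely regular and Hausdorff) space. The free locally convex space over $X$ is a locally convex space $L(X)$ together with a continuous map $i\colon X\to L(X)$ such that for every continuous map $f$ from $X$ to a locally convex space $E$ there is a unique continuous linear operator $\bar f\colon L(X)\to E$ with $f=\bar f\circ i$; it always exists and is unique up to a topological isomorphism compatible with the maps $i$. A topological space $Y$ is called $\kappa$-Fréchet–Urysohn if for every open subset $U\subseteq Y$ and every $y\in\overline{U}$ there is a sequence $(y_n)_{n\in\mathbb{N}}$ of points of $U$ converging to $y$. Then $L(X)$ is $\kappa$-Fréchet–Urysohn if and only if $X$ is finite. -/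

import Mathlib

open Filter Topology

universe u v

/-- A topological space `Y` is κ-Fréchet–Urysohn if every point of the closure of an open set `U`
is the limit of a sequence of points of `U`. -/
def IsKappaFrechetUrysohn (Y : Type u) [TopologicalSpace Y] : Prop :=
  ∀ U : Set Y, IsOpen U → ∀ y ∈ closure U,
    ∃ s : ℕ → Y, (∀ n, s n ∈ U) ∧ Tendsto s atTop (𝓝 y)

/-- The universal property of the free locally convex space over a topological space `X`, for
scalars `𝕜 = ℝ` or `ℂ`: the map `i : X → L` is continuous, and every continuous map `f` from `X`
to a (Hausdorff) locally convex space `E` over `𝕜` factors as `f = F ∘ i` for a unique continuous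
linear operator `F : L → E`.

The scalar action of `ℝ` on `E` (only used to speak of convex sets) is the restriction of that
of `𝕜`, by `IsScalarTower ℝ 𝕜 E`. -/
structure IsFreeLocallyConvexSpace (𝕜 : Type) [RCLike 𝕜] {X L : Type u} [TopologicalSpace X]
    [AddCommGroup L] [Module 𝕜 L] [TopologicalSpace L] (i : X → L) : Prop where
  continuous : Continuous i
  existsUnique_lift : ∀ (E : Type u) [AddCommGroup E] [Module 𝕜 E] [Module ℝ E]
    [IsScalarTower ℝ 𝕜 E] [TopologicalSpace E] [IsTopologicalAddGroup E] [ContinuousSMul 𝕜 E]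
    [LocallyConvexSpace ℝ E] [T2Space E] (f : X → E), Continuous f →
    ∃! F : L →L[𝕜] E, f = F ∘ i

/-! The free locally convex space over a Tychonoff space exists: it is the space of formal finite
linear combinations of points of `X`, with the finest locally convex topology for which the
embedding of `X` is continuous. -/

/-- Formal finite `𝕜`-linear combinations of points of `X`. -/
def FreeLCS (𝕜 : Type) [RCLike 𝕜] (X : Type u) : Type u := X →₀ 𝕜

namespace FreeLCS

variable (𝕜 : Type) [RCLike 𝕜] (X : Type u)

noncomputable instance : AddCommGroup (FreeLCS 𝕜 X) := inferInstanceAs (AddCommGroup (X →₀ 𝕜))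

noncomputable instance : Module 𝕜 (FreeLCS 𝕜 X) := inferInstanceAs (Module 𝕜 (X →₀ 𝕜))

noncomputable instance : Module ℝ (FreeLCS 𝕜 X) := inferInstanceAs (Module ℝ (X →₀ 𝕜))

instance : IsScalarTower ℝ 𝕜 (FreeLCS 𝕜 X) := inferInstanceAs (IsScalarTower ℝ 𝕜 (X →₀ 𝕜))

/-- The point `x`, as a formal linear combination. -/
noncomputable def of (x : X) : FreeLCS 𝕜 X := Finsupp.single x (1 : 𝕜)

variable {X}

/-- The linear extension of `f : X → E`. -/
noncomputable def lift {E : Type v} [AddCommGroup E] [Module 𝕜 E] (f : X → E) :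
    FreeLCS 𝕜 X →ₗ[𝕜] E :=
  Finsupp.linearCombination 𝕜 f

theorem lift_of {E : Type v} [AddCommGroup E] [Module 𝕜 E] (f : X → E) (x : X) :
    lift 𝕜 f (of 𝕜 X x) = f x :=
  (Finsupp.linearCombination_single 𝕜 (1 : 𝕜) x).trans (one_smul 𝕜 (f x))

theorem linearMap_ext {E : Type v} [AddCommGroup E] [Module 𝕜 E] {F G : FreeLCS 𝕜 X →ₗ[𝕜] E}
    (h : ∀ x, F (of 𝕜 X x) = G (of 𝕜 X x)) : F = G :=
  Finsupp.lhom_ext' fun x => LinearMap.ext_ring (h x)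

variable (X) [TopologicalSpace X]

/-- The locally convex vector space topologies for which the embedding of `X` is continuous. -/
def topologies : Set (TopologicalSpace (FreeLCS 𝕜 X)) :=
  {t | @IsTopologicalAddGroup _ t _ ∧ @ContinuousSMul 𝕜 _ _ _ t ∧ @LocallyConvexSpace ℝ _ _ _ _ _ t ∧
    Continuous[_, t] (of 𝕜 X)}

instance : TopologicalSpace (FreeLCS 𝕜 X) := sInf (topologies 𝕜 X)

instance : IsTopologicalAddGroup (FreeLCS 𝕜 X) := topologicalAddGroup_sInf fun _ h => h.1

instance : ContinuousSMul 𝕜 (FreeLCS 𝕜 X) := continuousSMul_sInf fun _ h => h.2.1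

instance : LocallyConvexSpace ℝ (FreeLCS 𝕜 X) := LocallyConvexSpace.sInf fun _ h => h.2.2.1

theorem continuous_of : Continuous (of 𝕜 X) := continuous_sInf_rng.2 fun _ h => h.2.2.2

variable {X}

theorem continuous_lift {E : Type v} [AddCommGroup E] [Module 𝕜 E] [Module ℝ E]
    [IsScalarTower ℝ 𝕜 E] [TopologicalSpace E] [IsTopologicalAddGroup E] [ContinuousSMul 𝕜 E]
    [LocallyConvexSpace ℝ E] {f : X → E} (hf : Continuous f) : Continuous (lift 𝕜 f) := by
  rw [continuous_iff_le_induced]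
  refine sInf_le ⟨topologicalAddGroup_induced (lift 𝕜 f), continuousSMul_induced (lift 𝕜 f),
    LocallyConvexSpace.induced ((lift 𝕜 f).restrictScalars ℝ), ?_⟩
  rw [continuous_induced_rng]
  convert hf using 1
  exact funext (lift_of 𝕜 f)

/-- The universal property of `FreeLCS`, for spaces in every universe. -/
theorem existsUnique_lift {E : Type v} [AddCommGroup E] [Module 𝕜 E] [Module ℝ E]
    [IsScalarTower ℝ 𝕜 E] [TopologicalSpace E] [IsTopologicalAddGroup E] [ContinuousSMul 𝕜 E]
    [LocallyConvexSpace ℝ E] (f : X → E) (hf : Continuous f) :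
    ∃! F : FreeLCS 𝕜 X →L[𝕜] E, f = F ∘ of 𝕜 X := by
  refine ⟨⟨lift 𝕜 f, continuous_lift 𝕜 hf⟩, (funext (lift_of 𝕜 f)).symm, fun G hG => ?_⟩
  refine ContinuousLinearMap.coe_injective (linearMap_ext 𝕜 fun x => ?_)
  exact (congrFun hG x).symm.trans (lift_of 𝕜 f x).symm

theorem isFree : IsFreeLocallyConvexSpace 𝕜 (of 𝕜 X) :=
  ⟨continuous_of 𝕜 X, fun _ => existsUnique_lift 𝕜⟩

/-- Continuous functions on a Tychonoff space separate formal linear combinations. -/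
theorem exists_linearCombination_ne_zero [T35Space X] (c : X →₀ 𝕜) (hc : c ≠ 0) :
    ∃ g : C(X, 𝕜), Finsupp.linearCombination 𝕜 g c ≠ 0 := by
  classical
  obtain ⟨x, hx⟩ := Finsupp.ne_iff.1 hc
  obtain ⟨g, hg, hgx, hgK⟩ := CompletelyRegularSpace.completely_regular x
    ((c.support.erase x : Finset X) : Set X) (Finset.finite_toSet _).isClosed (by simp)
  refine ⟨⟨fun y => ((1 - (g y : ℝ) : ℝ) : 𝕜), by fun_prop⟩, ?_⟩
  rw [Finsupp.linearCombination_apply, Finsupp.sum, Finset.sum_eq_single x]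
  · simpa [hgx] using hx
  · intro y hy hyx
    have := hgK (Finset.mem_coe.2 (Finset.mem_erase.2 ⟨hyx, hy⟩))
    simp [this]
  · intro h0
    simp [Finsupp.notMem_support_iff.1 h0]

instance [T35Space X] : T2Space (FreeLCS 𝕜 X) := by
  refine T2Space.of_injective_continuous
    (Y := (C(X, 𝕜) → 𝕜)) (f := fun a g => lift 𝕜 g a) ?_ ?_
  · intro a b hab
    by_contra hne
    obtain ⟨g, hg⟩ := exists_linearCombination_ne_zero 𝕜 (a - b : FreeLCS 𝕜 X) (sub_ne_zero.2 hne)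
    refine hg ?_
    change lift 𝕜 g (a - b) = 0
    rw [map_sub, sub_eq_zero]
    exact congrFun hab g
  · exact continuous_pi fun g => continuous_lift 𝕜 g.continuous

end FreeLCS

theorem IsKappaFrechetUrysohn.of_homeomorph {Y Z : Type*} [TopologicalSpace Y]
    [TopologicalSpace Z] (e : Y ≃ₜ Z) (h : IsKappaFrechetUrysohn Y) :
    IsKappaFrechetUrysohn Z := by
  intro U hU z hz
  obtain ⟨s, hs, hlim⟩ := h (e ⁻¹' U) (hU.preimage e.continuous) (e.symm z) (by
    rw [← e.preimage_closure]; simpa using hz)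
  refine ⟨fun n => e (s n), hs, ?_⟩
  simpa [Function.comp_def] using (e.continuous.tendsto _).comp hlim

theorem IsKappaFrechetUrysohn.of_frechetUrysohnSpace (Y : Type*) [TopologicalSpace Y]
    [FrechetUrysohnSpace Y] : IsKappaFrechetUrysohn Y :=
  fun _ _ _ hy => mem_closure_iff_seq_limit.1 hy

/-- In a κ-Fréchet–Urysohn Hausdorff group with a nontrivial sequence converging to `0`, one can
diagonalize through a sequence of open sets having `0` in their closures. -/
theorem IsKappaFrechetUrysohn.exists_diagonal {Y : Type*} [AddCommGroup Y] [TopologicalSpace Y]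
    [IsTopologicalAddGroup Y] [T2Space Y] (h : IsKappaFrechetUrysohn Y) {a : ℕ → Y}
    (ha : Tendsto a atTop (𝓝 0)) (ha0 : ∀ n, a n ≠ 0) {U : ℕ → Set Y} (hU : ∀ n, IsOpen (U n))
    (hU0 : ∀ n, (0 : Y) ∈ closure (U n)) :
    ∃ φ : ℕ → ℕ, StrictMono φ ∧ ∃ y : ℕ → Y, (∀ k, y k ∈ U (φ k)) ∧ Tendsto y atTop (𝓝 0) := by
  choose W W' hW hW' h0W haW' hdisj using fun n => t2_separation (neg_ne_zero.2 (ha0 n)).symm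
  -- The translates `a n + (U n ∩ W n)` have `a n`, hence in the limit `0`, in the closure of their
  -- union.
  have hopen : IsOpen (⋃ n, (fun z => z - a n) ⁻¹' (U n ∩ W n)) :=
    isOpen_iUnion fun n => ((hU n).inter (hW n)).preimage (by fun_prop)
  have hcl : ∀ n, a n ∈ closure (⋃ n, (fun z => z - a n) ⁻¹' (U n ∩ W n)) := by
    intro n
    refine closure_mono (Set.subset_iUnion _ n) ?_
    have h1 : (fun z => z - a n) ⁻¹' (U n ∩ W n) =
        (Homeomorph.subRight (a n)) ⁻¹' (U n ∩ W n) := rfl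
    rw [h1, ← Homeomorph.preimage_closure]
    have h2 : (0 : Y) ∈ closure (U n ∩ W n) := by
      rw [Set.inter_comm]
      exact (hW n).inter_closure ⟨h0W n, hU0 n⟩
    simpa using h2
  obtain ⟨s, hs, hlim⟩ := h _ hopen 0
    (isClosed_closure.mem_of_tendsto ha (Eventually.of_forall hcl))
  choose m hm using fun k => Set.mem_iUnion.1 (hs k)
  -- No index `n` recurs infinitely often: `s k - a n` tends to `-a n`, so it eventually lies in `W'
  -- n`, which misses `W n`.
  have hm_top : Tendsto m atTop atTop := by
    rw [← Nat.cofinite_eq_atTop]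
    refine Tendsto.cofinite_of_finite_preimage_singleton fun n => ?_
    have h1 : Tendsto (fun k => s k - a n) atTop (𝓝 (-a n)) := by
      simpa using hlim.sub_const (a n)
    have h2 := h1.eventually ((hW' n).mem_nhds (haW' n))
    rw [← Nat.cofinite_eq_atTop, eventually_cofinite] at h2
    refine h2.subset fun k hk hk' => ?_
    have hk : m k = n := hk
    exact Set.disjoint_left.1 (hdisj n) (hk ▸ (hm k).2) hk'
  obtain ⟨ψ, hψ, hφ⟩ := strictMono_subseq_of_tendsto_atTop hm_top
  refine ⟨m ∘ ψ, hφ, fun k => s (ψ k) - a (m (ψ k)), fun k => (hm (ψ k)).1, ?_⟩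
  simpa using (hlim.comp hψ.tendsto_atTop).sub (ha.comp (hm_top.comp hψ.tendsto_atTop))

/-- Free locally convex spaces over the same space are isomorphic. -/
theorem IsFreeLocallyConvexSpace.nonempty_equiv_freeLCS {𝕜 : Type} [RCLike 𝕜] {X : Type u}
    [TopologicalSpace X] [T35Space X] {L : Type u} [AddCommGroup L] [Module 𝕜 L] [Module ℝ L]
    [IsScalarTower ℝ 𝕜 L] [TopologicalSpace L] [IsTopologicalAddGroup L] [ContinuousSMul 𝕜 L]
    [LocallyConvexSpace ℝ L] [T2Space L] {i : X → L} (hi : IsFreeLocallyConvexSpace 𝕜 i) :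
    Nonempty (L ≃L[𝕜] FreeLCS 𝕜 X) := by
  obtain ⟨F, hF, -⟩ := hi.existsUnique_lift (FreeLCS 𝕜 X) (FreeLCS.of 𝕜 X)
    (FreeLCS.continuous_of 𝕜 X)
  obtain ⟨G, hG, -⟩ := FreeLCS.existsUnique_lift 𝕜 i hi.continuous
  have hFx : ∀ x, F (i x) = FreeLCS.of 𝕜 X x := fun x => (congrFun hF x).symm
  have hGx : ∀ x, G (FreeLCS.of 𝕜 X x) = i x := fun x => (congrFun hG x).symm
  have hGF : G.comp F = ContinuousLinearMap.id 𝕜 L :=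
    (hi.existsUnique_lift L i hi.continuous).unique
      (funext fun x => by simp [hFx, hGx]) (funext fun x => by simp)
  have hFG : F.comp G = ContinuousLinearMap.id 𝕜 (FreeLCS 𝕜 X) :=
    (FreeLCS.existsUnique_lift 𝕜 _ (FreeLCS.continuous_of 𝕜 X)).unique
      (funext fun x => by simp [hFx, hGx]) (funext fun x => by simp)
  exact ⟨ContinuousLinearEquiv.equivOfInverse F G (fun x => congrArg (· x) hGF)
    (fun x => congrArg (· x) hFG)⟩

namespace FreeLCS

variable (𝕜 : Type) [RCLike 𝕜] {X : Type u}

theorem of_ne_zero (x : X) : of 𝕜 X x ≠ 0 :=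
  fun h => one_ne_zero (Finsupp.single_eq_zero.1 (h : Finsupp.single x (1 : 𝕜) = 0))

/-- The coefficient of a formal linear combination at a point. -/
noncomputable def coeff (x : X) : FreeLCS 𝕜 X →ₗ[𝕜] 𝕜 := Finsupp.lapply x

open Classical in
theorem coeff_of (x y : X) : coeff 𝕜 x (of 𝕜 X y) = if y = x then 1 else 0 :=
  Finsupp.single_apply

variable (X) [TopologicalSpace X]

theorem isKappaFrechetUrysohn_of_finite [T35Space X] [Finite X] :
    IsKappaFrechetUrysohn (FreeLCS 𝕜 X) := by
  have : FiniteDimensional 𝕜 (FreeLCS 𝕜 X) := inferInstanceAs (FiniteDimensional 𝕜 (X →₀ 𝕜))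
  exact IsKappaFrechetUrysohn.of_homeomorph
    (ContinuousLinearEquiv.ofFinrankEq (𝕜 := 𝕜) (E := Fin (Module.finrank 𝕜 (FreeLCS 𝕜 X)) → 𝕜)
      (F := FreeLCS 𝕜 X) (by simp)).toHomeomorph (.of_frechetUrysohnSpace _)

theorem tendsto_smul_nhds_zero (v : FreeLCS 𝕜 X) :
    Tendsto (fun n : ℕ => ((n : 𝕜) + 1)⁻¹ • v) atTop (𝓝 0) := by
  have h : Tendsto (fun n : ℕ => ((n : 𝕜) + 1)⁻¹) atTop (𝓝 0) := by
    simpa using tendsto_one_div_add_atTop_nhds_zero_nat (𝕜 := 𝕜)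
  simpa using h.smul_const v

variable {X}

/-- Diagonalization in a κ-Fréchet–Urysohn free locally convex space. -/
theorem exists_diagonal [T35Space X] [Nonempty X] (h : IsKappaFrechetUrysohn (FreeLCS 𝕜 X))
    {U : ℕ → Set (FreeLCS 𝕜 X)} (hU : ∀ n, IsOpen (U n))
    (hU0 : ∀ n, (0 : FreeLCS 𝕜 X) ∈ closure (U n)) :
    ∃ φ : ℕ → ℕ, StrictMono φ ∧ ∃ y : ℕ → FreeLCS 𝕜 X,
      (∀ k, y k ∈ U (φ k)) ∧ Tendsto y atTop (𝓝 0) := by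
  obtain ⟨x⟩ := ‹Nonempty X›
  exact h.exists_diagonal (tendsto_smul_nhds_zero 𝕜 X (of 𝕜 X x))
    (fun n => smul_ne_zero (inv_ne_zero (Nat.cast_add_one_ne_zero n)) (of_ne_zero 𝕜 x)) hU hU0

/-- The functional on bounded continuous functions given by a formal linear combination. -/
noncomputable def toDual : FreeLCS 𝕜 X →ₗ[𝕜] (BoundedContinuousFunction X 𝕜 →L[𝕜] 𝕜) :=
  lift 𝕜 fun x => BoundedContinuousFunction.evalCLM 𝕜 x

theorem toDual_apply (a : FreeLCS 𝕜 X) (g : BoundedContinuousFunction X 𝕜) :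
    toDual 𝕜 a g = lift 𝕜 g a := by
  have h : (ContinuousLinearMap.apply 𝕜 𝕜 g).toLinearMap ∘ₗ toDual 𝕜 = lift 𝕜 g :=
    linearMap_ext 𝕜 fun x => by simp [toDual, lift_of]
  exact congrArg (· a) h

theorem continuous_toDual_apply (g : BoundedContinuousFunction X 𝕜) :
    Continuous fun a : FreeLCS 𝕜 X => toDual 𝕜 a g := by
  simp only [toDual_apply]
  exact continuous_lift 𝕜 g.continuous

/-- The dual norm need not be continuous here, but as a supremum of continuous functions it is lower
semicontinuous. -/
theorem isOpen_lt_norm_toDual (r : ℝ) : IsOpen {a : FreeLCS 𝕜 X | r < ‖toDual 𝕜 a‖} := by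
  rcases lt_or_ge r 0 with hr | hr
  · convert isOpen_univ
    exact Set.eq_univ_of_forall fun a => hr.trans_le (norm_nonneg _)
  · have h : {a : FreeLCS 𝕜 X | r < ‖toDual 𝕜 a‖} =
        ⋃ g : BoundedContinuousFunction X 𝕜, {a | r * ‖g‖ < ‖toDual 𝕜 a g‖} := by
      ext a
      simp only [Set.mem_ofPred_eq, Set.mem_iUnion]
      refine ⟨fun ha => ?_, fun ⟨g, hg⟩ => ?_⟩
      · by_contra! hcon
        exact ha.not_ge (ContinuousLinearMap.opNorm_le_bound _ hr hcon)
      · exact lt_of_mul_lt_mul_right (hg.trans_le ((toDual 𝕜 a).le_opNorm g)) (norm_nonneg g)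
    rw [h]
    exact isOpen_iUnion fun g => isOpen_lt continuous_const (continuous_toDual_apply 𝕜 g).norm

theorem one_le_norm_toDual_of_sub_of [T35Space X] {x y : X} (hxy : y ≠ x) :
    1 ≤ ‖toDual 𝕜 (of 𝕜 X y - of 𝕜 X x)‖ := by
  obtain ⟨g, hg, hgx, hgy⟩ := CompletelyRegularSpace.completely_regular x {y}
    isClosed_singleton (by simpa using hxy.symm)
  have hgy : g y = 1 := hgy rfl
  let G : BoundedContinuousFunction X 𝕜 := BoundedContinuousFunction.ofNormedAddCommGroup
    (fun z => ((g z : ℝ) : 𝕜)) (by fun_prop) 1 fun z => by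
      simpa [abs_of_nonneg (g z).2.1] using (g z).2.2
  have hG : ‖G‖ ≤ 1 := BoundedContinuousFunction.norm_ofNormedAddCommGroup_le _ zero_le_one _
  have h1 : toDual 𝕜 (of 𝕜 X y - of 𝕜 X x) G = 1 := by
    rw [toDual_apply, map_sub, lift_of, lift_of]
    simp [G, hgx, hgy]
  calc (1 : ℝ) = ‖toDual 𝕜 (of 𝕜 X y - of 𝕜 X x) G‖ := by rw [h1, norm_one]
    _ ≤ ‖toDual 𝕜 (of 𝕜 X y - of 𝕜 X x)‖ * ‖G‖ := ContinuousLinearMap.le_opNorm _ _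
    _ ≤ _ := mul_le_of_le_one_right (norm_nonneg _) hG

/-- As `y → x`, the vectors `(n + 1) • (of y - of x)` tend to `0`, yet their norms stay at least `n
+ 1`. -/
theorem zero_mem_closure_lt_norm_toDual [T35Space X] (x : X) [(𝓝[≠] x).NeBot] (n : ℕ) :
    (0 : FreeLCS 𝕜 X) ∈ closure {a | (n : ℝ) < ‖toDual 𝕜 a‖} := by
  have hc : Continuous fun y => ((n : 𝕜) + 1) • (of 𝕜 X y - of 𝕜 X x) := by
    have := continuous_of 𝕜 X
    fun_prop
  have hlim : Tendsto (fun y => ((n : 𝕜) + 1) • (of 𝕜 X y - of 𝕜 X x)) (𝓝[≠] x) (𝓝 0) := by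
    simpa using (hc.tendsto x).mono_left nhdsWithin_le_nhds
  refine mem_closure_of_tendsto hlim (eventually_nhdsWithin_of_forall fun y hy => ?_)
  have h1 := one_le_norm_toDual_of_sub_of 𝕜 (x := x) (y := y) hy
  have h2 : ‖(n : 𝕜) + 1‖ = n + 1 := by
    exact_mod_cast RCLike.norm_natCast (K := 𝕜) (n + 1)
  rw [Set.mem_ofPred_eq, map_smul, norm_smul, h2]
  nlinarith [Nat.cast_nonneg (α := ℝ) n]

theorem discreteTopology_of_isKappaFrechetUrysohn [T35Space X]
    (h : IsKappaFrechetUrysohn (FreeLCS 𝕜 X)) : DiscreteTopology X := by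
  refine discreteTopology_iff_nhds_ne.2 fun x => ?_
  by_contra hx
  have : (𝓝[≠] x).NeBot := ⟨hx⟩
  have : Nonempty X := ⟨x⟩
  obtain ⟨φ, hφ, y, hy, hlim⟩ := exists_diagonal 𝕜 h
    (fun n : ℕ => isOpen_lt_norm_toDual 𝕜 (X := X) n) (zero_mem_closure_lt_norm_toDual 𝕜 x)
  obtain ⟨C, hC⟩ := banach_steinhaus (g := fun k => toDual 𝕜 (y k)) fun g => by
    have h1 := (((continuous_toDual_apply 𝕜 g).tendsto 0).comp hlim).norm.bddAbove_range
    obtain ⟨C, hC⟩ := h1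
    exact ⟨C, fun k => hC ⟨k, rfl⟩⟩
  obtain ⟨k, hk⟩ := exists_nat_gt C
  have h2 : (k : ℝ) ≤ φ k := by exact_mod_cast hφ.le_apply
  have h3 : (φ k : ℝ) < ‖toDual 𝕜 (y k)‖ := hy k
  linarith [hC k]

theorem continuous_coeff [DiscreteTopology X] (x : X) : Continuous (coeff 𝕜 x) := by
  have h : coeff 𝕜 x = lift 𝕜 fun y => coeff 𝕜 x (of 𝕜 X y) :=
    linearMap_ext 𝕜 fun y => (lift_of 𝕜 (fun y => coeff 𝕜 x (of 𝕜 X y)) y).symm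
  rw [h]
  exact continuous_lift 𝕜 continuous_of_discreteTopology

/-- Over a discrete space, a sequence converging to `0` does so uniformly with respect to any
weights on the coefficients. -/
theorem tendsto_mul_coeff_zero [DiscreteTopology X] {y : ℕ → FreeLCS 𝕜 X}
    (hy : Tendsto y atTop (𝓝 0)) (w : X → 𝕜) (x : ℕ → X) :
    Tendsto (fun k => w (x k) * coeff 𝕜 (x k) (y k)) atTop (𝓝 0) := by
  classical
  -- `f z` is `w z` times the indicator of `z`. Discreteness makes `f` continuous for the sup norm
  -- even if `w` is unbounded.
  let f : X → BoundedContinuousFunction X 𝕜 := fun z =>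
    BoundedContinuousFunction.ofNormedAddCommGroupDiscrete
      (fun t => w t * coeff 𝕜 t (of 𝕜 X z)) ‖w z‖ fun t => by
        rw [coeff_of]
        split_ifs with h <;> simp [h]
  have hf : ∀ (a : FreeLCS 𝕜 X) (t : X), lift 𝕜 f a t = w t * coeff 𝕜 t a := by
    intro a t
    have h : (BoundedContinuousFunction.evalCLM 𝕜 t).toLinearMap ∘ₗ lift 𝕜 f =
        w t • coeff 𝕜 t := linearMap_ext 𝕜 fun z => by simp [lift_of, f]
    exact congrArg (· a) h
  have hlim : Tendsto (fun k => lift 𝕜 f (y k)) atTop (𝓝 0) := by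
    simpa [Function.comp_def] using ((continuous_lift 𝕜 (f := f) continuous_of_discreteTopology).tendsto 0).comp hy
  refine squeeze_zero_norm (fun k => ?_) (tendsto_zero_iff_norm_tendsto_zero.1 hlim)
  rw [← hf]
  exact (lift 𝕜 f (y k)).norm_coe_le_norm (x k)

theorem finite_of_isKappaFrechetUrysohn [T35Space X]
    (h : IsKappaFrechetUrysohn (FreeLCS 𝕜 X)) : Finite X := by
  by_contra hX
  have : Infinite X := not_finite_iff_infinite.1 hX
  have : DiscreteTopology X := discreteTopology_of_isKappaFrechetUrysohn 𝕜 h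
  let x := Infinite.natEmbedding X
  obtain ⟨φ, hφ, y, hy, hlim⟩ := exists_diagonal 𝕜 h
    (U := fun n => {a | coeff 𝕜 (x n) a ≠ 0})
    (fun n => isOpen_ne_fun (continuous_coeff 𝕜 (x n)) continuous_const) fun n =>
      mem_closure_of_tendsto (tendsto_smul_nhds_zero 𝕜 X (of 𝕜 X (x n)))
        (Eventually.of_forall fun m => by
          simpa [coeff_of] using Nat.cast_add_one_ne_zero (R := 𝕜) m)
  have hinj : Function.Injective fun k => x (φ k) := x.injective.comp hφ.injective
  -- The weight at `x (φ k)` is the inverse of the coefficient of `y k` there, so the null sequence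
  -- obtained is constantly `1`.
  have h1 := tendsto_mul_coeff_zero 𝕜 hlim
    (Function.extend (fun k => x (φ k)) (fun k => (coeff 𝕜 (x (φ k)) (y k))⁻¹) 0)
    fun k => x (φ k)
  have h2 : ∀ k, coeff 𝕜 (x (φ k)) (y k) ≠ 0 := hy
  simp [hinj.extend_apply, h2] at h1

end FreeLCS

/-- Let `X` be a Tychonoff space and let `(L, i)` be the free locally convex space over `X`
(it exists, see `FreeLCS.isFree`). Then `L` is κ-Fréchet–Urysohn if and only if `X` is finite. -/
theorem corollary2p8 (𝕜 : Type) [RCLike 𝕜] (X : Type u) [TopologicalSpace X] [T35Space X]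
    (L : Type u) [AddCommGroup L] [Module 𝕜 L] [Module ℝ L] [IsScalarTower ℝ 𝕜 L]
    [TopologicalSpace L] [IsTopologicalAddGroup L] [ContinuousSMul 𝕜 L] [LocallyConvexSpace ℝ L]
    [T2Space L] (i : X → L) (hi : IsFreeLocallyConvexSpace 𝕜 i) :
    IsKappaFrechetUrysohn L ↔ Finite X := by
  obtain ⟨e⟩ := hi.nonempty_equiv_freeLCS
  refine ⟨fun h => ?_, fun h => ?_⟩
  · exact FreeLCS.finite_of_isKappaFrechetUrysohn 𝕜 (h.of_homeomorph e.toHomeomorph)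
  · exact (FreeLCS.isKappaFrechetUrysohn_of_finite 𝕜 X).of_homeomorph e.symm.toHomeomorph
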